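/- Let $\mathbb{C}^*=\mathbb{C}\setminus\{0\}$, and let $\mathbb{P}^n$ be the complex projective space of dimension $n$ with the Fubini--Study metric, normalized so that its diameter is $\pi/2$. A holomorphic curve $f:\mathbb{C}^*\to\mathbb{P}^n$ is a holomorphic map; its spherical derivative $f^\#\ge 0$ is given by $$\bigl(f^\#\bigr)^2=\frac{\sum_{0\le i<j\le n}|f_i'f_j-f_if_j'|^2}{\bigl(|f_0|^2+\dots+|f_n|^2\bigr)^2},$$ where $(f_0:\dots:f_n)$ is a (local) representation of $f$ by homogeneous coordinates that are holomorphic functions without common zeros; $f^\#$ does not depend on the choice of this representation. **Theorem.** For every $n$ and every non-constant holomorphic curve $f:\mathbb{C}^*\to\mathbb{P}^n$, $$\sup_{z\in\mathbb{C}^*}|z|\,f^\#(z)\ \ge\ \frac12,$$ where the supremum may be $+\infty$. Consequently, for $0<K<1/2$ the class $\mathfrak{O}_1(K)$ of all holomorphic curves $f:\mathbb{C}^*\to\mathbb{P}^1$ with $\sup_{z\in\mathbb{C}^*}|z|f^\#(z)\le K$ consists precisely of the constant maps. -/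

import Mathlib

noncomputable section

/-- The space `ℂⁿ⁺¹` with its standard Hermitian product. -/
abbrev CSpace (n : ℕ) : Type := EuclideanSpace ℂ (Fin (n + 1))

/-- The complex projective space of dimension `n`. -/
abbrev CProj (n : ℕ) : Type := Projectivization ℂ (CSpace n)

/-- The punctured plane `ℂ* = ℂ \ {0}`. -/
abbrev PuncturedPlane : Set ℂ := {0}ᶜ

/-- `F` is a reduced homogeneous representation of `f` on `U ⊆ G`: a holomorphic map on `U`
whose coordinates have no common zeros and whose projection to projective space is `f`. -/
def IsReducedRepOn {G : Set ℂ} {n : ℕ} (f : G → CProj n) (U : Set ℂ) (F : ℂ → CSpace n) : Prop :=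
  DifferentiableOn ℂ F U ∧
    ∀ z ∈ U, ∃ (hG : z ∈ G) (h0 : F z ≠ 0), f ⟨z, hG⟩ = Projectivization.mk ℂ (F z) h0

/-- `F` is a reduced homogeneous representation of `f` on some open neighbourhood of `a`. -/
def IsReducedRepNear {G : Set ℂ} {n : ℕ} (f : G → CProj n) (a : ℂ) (F : ℂ → CSpace n) : Prop :=
  ∃ U : Set ℂ, IsOpen U ∧ a ∈ U ∧ IsReducedRepOn f U F

/-- Holomorphic curves `G → ℙⁿ`, for `G ⊆ ℂ` open. The complex structure of `ℙⁿ` is the quotient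
structure of `ℂⁿ⁺¹ \ {0}`, so `f` is holomorphic if and only if it lifts locally to a holomorphic
map with values in `ℂⁿ⁺¹ \ {0}`. No global lift is required. -/
def IsHolomorphicCurve {G : Set ℂ} {n : ℕ} (f : G → CProj n) : Prop :=
  ∀ a : G, ∃ F : ℂ → CSpace n, IsReducedRepNear f a F

/-- The Fubini--Study length, at the point of homogeneous coordinates `ζ`, of the image of the
tangent vector `v` to `ℂⁿ⁺¹` at `ζ`:
the square root of `(∑_{i<j} |v_i ζ_j - ζ_i v_j|²) / ‖ζ‖⁴`. -/
def fubiniStudyLength {n : ℕ} (ζ v : CSpace n) : ℝ :=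
  Real.sqrt ((∑ i : Fin (n + 1), ∑ j ∈ Finset.Ioi i, ‖v i * ζ j - ζ i * v j‖ ^ 2) / ‖ζ‖ ^ 4)

open Classical in
/-- The spherical derivative `f^#(a)`: the Fubini--Study length of `F'(a)` at `F(a)`, for any
reduced representation `F` of `f` near `a` (see `sphericalDeriv_eq` for the independence of `F`;
the value `0` is a default for maps that are not holomorphic near `a`). -/
def sphericalDeriv {G : Set ℂ} {n : ℕ} (f : G → CProj n) (a : G) : ℝ :=
  if h : ∃ F : ℂ → CSpace n, IsReducedRepNear f a F then
    fubiniStudyLength (h.choose a) (deriv h.choose a)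
  else 0

theorem fubiniStudyLength_smul {n : ℕ} (ζ v : CSpace n) (c d : ℂ) (hc : c ≠ 0) :
    fubiniStudyLength (c • ζ) (c • v + d • ζ) = fubiniStudyLength ζ v := by
  unfold fubiniStudyLength
  have h1 : ∀ i j : Fin (n + 1),
      ‖(c • v + d • ζ) i * (c • ζ) j - (c • ζ) i * (c • v + d • ζ) j‖ ^ 2
        = ‖c‖ ^ 4 * ‖v i * ζ j - ζ i * v j‖ ^ 2 := by
    intro i j
    have : (c • v + d • ζ) i * (c • ζ) j - (c • ζ) i * (c • v + d • ζ) j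
        = c ^ 2 * (v i * ζ j - ζ i * v j) := by
      simp only [PiLp.add_apply, PiLp.smul_apply, smul_eq_mul]
      ring
    rw [this, norm_mul, norm_pow]
    ring
  simp only [h1, ← Finset.mul_sum, norm_smul, mul_pow]
  rw [mul_div_mul_left]
  positivity

/-- The spherical derivative can be computed from any reduced representation. -/
theorem sphericalDeriv_eq {G : Set ℂ} {n : ℕ} (f : G → CProj n) (a : G) (F : ℂ → CSpace n)
    (hF : IsReducedRepNear f a F) :
    sphericalDeriv f a = fubiniStudyLength (F a) (deriv F a) := by
  have h : ∃ F : ℂ → CSpace n, IsReducedRepNear f a F := ⟨F, hF⟩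
  rw [sphericalDeriv, dif_pos h]
  obtain ⟨U, hU, haU, hdU, hUf⟩ := hF
  obtain ⟨V, hV, haV, hdV, hVf⟩ := h.choose_spec
  generalize h.choose = H at *
  have hFa : DifferentiableAt ℂ F a := hdU.differentiableAt (hU.mem_nhds haU)
  have hHa : DifferentiableAt ℂ H a := hdV.differentiableAt (hV.mem_nhds haV)
  have hscal : ∀ z ∈ U ∩ V, ∃ c : ℂ, c • F z = H z := by
    intro z hz
    obtain ⟨hG, h0, e⟩ := hUf z hz.1
    obtain ⟨_, h0', e'⟩ := hVf z hz.2
    rw [e] at e'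
    exact (Projectivization.mk_eq_mk_iff' ℂ _ _ h0' h0).1 e'.symm
  obtain ⟨_, hF0, _⟩ := hUf a haU
  obtain ⟨_, hH0, _⟩ := hVf a haV
  obtain ⟨k, hk⟩ : ∃ k, F a k ≠ 0 := by
    by_contra hcon
    push Not at hcon
    exact hF0 (by ext i; simpa using hcon i)
  have hFk : DifferentiableAt ℂ (fun z => F z k) a := by
    exact (differentiableAt_euclidean.1 hFa) k
  have hHk : DifferentiableAt ℂ (fun z => H z k) a := by
    exact (differentiableAt_euclidean.1 hHa) k
  have hc : DifferentiableAt ℂ (fun z => H z k / F z k) a := hHk.div hFk hk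
  have hev : H =ᶠ[nhds (a : ℂ)] fun z => (H z k / F z k) • F z := by
    filter_upwards [(hU.inter hV).mem_nhds ⟨haU, haV⟩,
      hFk.continuousAt.eventually_ne hk] with z hz hzk
    obtain ⟨c, hcz⟩ := hscal z hz
    rw [← hcz]
    simp [hzk]
  have hval : H a = (H a k / F a k) • F a := hev.self_of_nhds
  have hderiv := hev.deriv_eq
  rw [deriv_fun_smul hc hFa] at hderiv
  generalize deriv (fun z => H z k / F z k) (a : ℂ) = d at hderiv
  generalize H a k / F a k = c at hval hderiv
  have hc0 : c ≠ 0 := by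
    rintro rfl
    rw [zero_smul] at hval
    exact hH0 hval
  rw [hderiv, hval]
  exact fubiniStudyLength_smul _ _ _ _ hc0

/-- `sup_{z ∈ ℂ*} |z| f^#(z)`, as an extended real number: it is `+∞` if the function
`|z| f^#(z)` is unbounded. -/
def normalitySup {n : ℕ} (f : PuncturedPlane → CProj n) : EReal :=
  ⨆ z : PuncturedPlane, ((‖(z : ℂ)‖ * sphericalDeriv f z : ℝ) : EReal)

/-- Normal curves in `ℂ*` with `sup |z| f^#(z) ≤ K`. -/
def NormalCurves (n : ℕ) (K : ℝ) : Set (PuncturedPlane → CProj n) :=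
  {f | IsHolomorphicCurve f ∧ normalitySup f ≤ (K : EReal)}

/-- The Ostrowski class `𝔒₁(K)`. -/
def OstrowskiClass (K : ℝ) : Set (PuncturedPlane → CProj 1) := NormalCurves 1 K

/-- Constant maps. -/
def IsConstantCurve {G : Set ℂ} {n : ℕ} (f : G → CProj n) : Prop :=
  ∃ p : CProj n, ∀ z : G, f z = p

end

/-! Pulling back by `exp` turns `f` into a curve `g` on ℂ with period 2πi, and `|z| f^#` becomes
`g^#`. Suppose `g^# ≤ K < 1/2`. The image of a vertical period segment is a loop of length at most
2πK < π, so it stays at distance less than π/2 from the image of the segment's midpoint, uniformly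
in `Re w = t`. Since π/2 is the distance from a point to its polar hyperplane, the loop lies in an
affine chart and bounds a well-defined signed area `A(t)`, namely half the integral of the
connection form ∂ log ‖F‖² of a lift `F` to that chart.

Two facts are played against each other. Stokes gives `A' = E`, where `E(t)` is the energy of the
loop (`hasDerivAt_enclosedArea`). An isoperimetric inequality gives `κ A² ≤ E` for a fixed `κ > 0`
(`mul_enclosedArea_sq_le`). Hence `κ A² ≤ A'` on all of ℝ. As `E ≤ 2πK²`, the function `A` is
bounded, and the only bounded global solution of this Riccati inequality is 0. Therefore `E = A' =
0`, and `g` is constant. -/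

noncomputable section

open Complex MeasureTheory Filter Topology

/-! ### Hermitian algebra of the Fubini–Study metric -/

/-- Lagrange's identity for complex vectors. -/
theorem sum_norm_mul_sub_mul_sq {n : ℕ} (ζ v : CSpace n) :
    ∑ i : Fin (n + 1), ∑ j ∈ Finset.Ioi i, ‖v i * ζ j - ζ i * v j‖ ^ 2
      = ‖ζ‖ ^ 2 * ‖v‖ ^ 2 - ‖inner ℂ ζ v‖ ^ 2 := by
  have hsym : ∑ i : Fin (n + 1), ∑ j, ‖v i * ζ j - ζ i * v j‖ ^ 2
      = 2 * ∑ i : Fin (n + 1), ∑ j ∈ Finset.Ioi i, ‖v i * ζ j - ζ i * v j‖ ^ 2 := by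
    have hsplit : ∀ i : Fin (n + 1), ∑ j, ‖v i * ζ j - ζ i * v j‖ ^ 2
        = ∑ j ∈ Finset.Ioi i, ‖v i * ζ j - ζ i * v j‖ ^ 2
          + ∑ j ∈ Finset.Iio i, ‖v i * ζ j - ζ i * v j‖ ^ 2 := by
      intro i
      have hd : Disjoint (Finset.Ioi i) (Finset.Iio i) := by
        rw [Finset.disjoint_left]
        intro j hj hj'
        simp only [Finset.mem_Ioi, Finset.mem_Iio] at hj hj'
        exact lt_asymm hj hj'
      rw [← Finset.sum_union hd]
      symm
      apply Finset.sum_subset (Finset.subset_univ _)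
      intro j _ hj
      have : j = i := by
        simp only [Finset.mem_union, Finset.mem_Ioi, Finset.mem_Iio, not_or, not_lt] at hj
        exact le_antisymm hj.1 hj.2
      subst this
      rw [mul_comm, sub_self]
      simp
    have hswap : ∑ i : Fin (n + 1), ∑ j ∈ Finset.Iio i, ‖v i * ζ j - ζ i * v j‖ ^ 2
        = ∑ i : Fin (n + 1), ∑ j ∈ Finset.Ioi i, ‖v i * ζ j - ζ i * v j‖ ^ 2 := by
      rw [Finset.sum_comm' (t' := Finset.univ) (s' := fun i => Finset.Ioi i) (by simp)]
      refine Finset.sum_congr rfl fun i _ => Finset.sum_congr rfl fun j _ => ?_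
      rw [norm_sub_rev]
      ring_nf
    rw [Finset.sum_congr rfl fun i _ => hsplit i, Finset.sum_add_distrib, hswap]
    ring
  -- Over ℂ each squared modulus is z · conj z, which makes the identity polynomial.
  have hexp : ((∑ i : Fin (n + 1), ∑ j, ‖v i * ζ j - ζ i * v j‖ ^ 2 : ℝ) : ℂ)
      = ((2 * (‖ζ‖ ^ 2 * ‖v‖ ^ 2 - ‖inner ℂ ζ v‖ ^ 2) : ℝ) : ℂ) := by
    have hζ : ((‖ζ‖ ^ 2 : ℝ) : ℂ) = ∑ i, ζ i * starRingEnd ℂ (ζ i) := by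
      rw [EuclideanSpace.norm_sq_eq]
      push_cast
      exact Finset.sum_congr rfl fun i _ => (Complex.mul_conj' _).symm
    have hv : ((‖v‖ ^ 2 : ℝ) : ℂ) = ∑ i, v i * starRingEnd ℂ (v i) := by
      rw [EuclideanSpace.norm_sq_eq]
      push_cast
      exact Finset.sum_congr rfl fun i _ => (Complex.mul_conj' _).symm
    have hi : ((‖inner ℂ ζ v‖ ^ 2 : ℝ) : ℂ)
        = (∑ i, v i * starRingEnd ℂ (ζ i)) * ∑ i, ζ i * starRingEnd ℂ (v i) := by
      push_cast
      rw [← Complex.mul_conj']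
      simp [PiLp.inner_apply, mul_comm]
    rw [Complex.ofReal_mul, Complex.ofReal_sub, Complex.ofReal_mul, hζ, hv, hi]
    push_cast
    simp only [← Complex.mul_conj', map_sub, map_mul]
    have : ∀ i j : Fin (n + 1), (v i * ζ j - ζ i * v j) *
        (starRingEnd ℂ (v i) * starRingEnd ℂ (ζ j) - starRingEnd ℂ (ζ i) * starRingEnd ℂ (v j))
        = (v i * starRingEnd ℂ (v i)) * (ζ j * starRingEnd ℂ (ζ j))
          + (ζ i * starRingEnd ℂ (ζ i)) * (v j * starRingEnd ℂ (v j))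
          - (v i * starRingEnd ℂ (ζ i)) * (ζ j * starRingEnd ℂ (v j))
          - (ζ i * starRingEnd ℂ (v i)) * (v j * starRingEnd ℂ (ζ j)) := by
      intro i j; ring
    simp only [this, Finset.sum_sub_distrib, Finset.sum_add_distrib, ← Finset.sum_mul_sum]
    ring
  have := Complex.ofReal_injective hexp
  linarith

theorem fubiniStudyLength_sq {n : ℕ} (ζ v : CSpace n) :
    fubiniStudyLength ζ v ^ 2 = (‖ζ‖ ^ 2 * ‖v‖ ^ 2 - ‖inner ℂ ζ v‖ ^ 2) / ‖ζ‖ ^ 4 := by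
  rw [fubiniStudyLength, Real.sq_sqrt (by positivity), sum_norm_mul_sub_mul_sq]

theorem fubiniStudyLength_smul_right {n : ℕ} (ζ v : CSpace n) (c : ℂ) :
    fubiniStudyLength ζ (c • v) = ‖c‖ * fubiniStudyLength ζ v := by
  have h0 : ∀ u : CSpace n, 0 ≤ fubiniStudyLength ζ u := fun u => Real.sqrt_nonneg _
  rw [← sq_eq_sq₀ (h0 _) (mul_nonneg (norm_nonneg _) (h0 _)), mul_pow,
    fubiniStudyLength_sq, fubiniStudyLength_sq, inner_smul_right, norm_smul, norm_mul]
  ring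

/-- The Cauchy--Schwarz inequality for the components of `a` and `v` orthogonal to `ζ`. -/
theorem norm_sq_inner_orthogonal_le {V : Type*} [NormedAddCommGroup V] [InnerProductSpace ℂ V]
    (a v ζ : V) (hζ : ζ ≠ 0) :
    ‖(‖ζ‖ ^ 2 : ℂ) * inner ℂ a v - inner ℂ a ζ * inner ℂ ζ v‖ ^ 2
      ≤ (‖ζ‖ ^ 2 * ‖a‖ ^ 2 - ‖inner ℂ a ζ‖ ^ 2) * (‖ζ‖ ^ 2 * ‖v‖ ^ 2 - ‖inner ℂ ζ v‖ ^ 2) := by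
  have hN : 0 < ‖ζ‖ := norm_pos_iff.2 hζ
  -- `‖ζ‖² u - ⟪ζ, u⟫ ζ` is the projection of `u` to the complement of `ζ`, scaled by `‖ζ‖²` to
  -- avoid denominators.
  have hinner : ∀ u u' : V, inner ℂ ((‖ζ‖ ^ 2 : ℂ) • u - inner ℂ ζ u • ζ)
      ((‖ζ‖ ^ 2 : ℂ) • u' - inner ℂ ζ u' • ζ)
      = (‖ζ‖ ^ 2 : ℂ) * ((‖ζ‖ ^ 2 : ℂ) * inner ℂ u u' - inner ℂ u ζ * inner ℂ ζ u') := by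
    intro u u'
    simp only [inner_sub_left, inner_sub_right, inner_smul_left, inner_smul_right,
      inner_self_eq_norm_sq_to_K, map_pow, inner_conj_symm, Complex.conj_ofReal,
      Complex.coe_algebraMap]
    ring
  have hnorm : ∀ u : V, ‖(‖ζ‖ ^ 2 : ℂ) • u - inner ℂ ζ u • ζ‖ ^ 2
      = ‖ζ‖ ^ 2 * (‖ζ‖ ^ 2 * ‖u‖ ^ 2 - ‖inner ℂ ζ u‖ ^ 2) := by
    intro u
    have h1 := hinner u u
    rw [inner_self_eq_norm_sq_to_K, inner_self_eq_norm_sq_to_K, ← inner_conj_symm u ζ,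
      Complex.conj_mul'] at h1
    apply Complex.ofReal_injective
    push_cast
    exact h1
  have hcs := norm_inner_le_norm (𝕜 := ℂ) ((‖ζ‖ ^ 2 : ℂ) • a - inner ℂ ζ a • ζ)
    ((‖ζ‖ ^ 2 : ℂ) • v - inner ℂ ζ v • ζ)
  have hcs2 := pow_le_pow_left₀ (norm_nonneg _) hcs 2
  rw [mul_pow, hnorm, hnorm, hinner, norm_mul, mul_pow, norm_inner_symm ζ a] at hcs2
  have hz : ‖(‖ζ‖ ^ 2 : ℂ)‖ = ‖ζ‖ ^ 2 := by simp
  rw [hz] at hcs2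
  have h4 : 0 < (‖ζ‖ ^ 2) ^ 2 := by positivity
  refine le_of_mul_le_mul_left ?_ h4
  linarith

/-! ### Scalar differential inequalities -/

/-- A function with `c 0 = 1` and `|c'| ≤ k √(1 - c²)`, where `k < 1`, stays away from `-1`
on `[0, π]`. -/
theorem cos_le_of_deriv_sq_le {c c' : ℝ → ℝ} {k : ℝ} (hk0 : 0 ≤ k) (hk : k < 1)
    (hc : ∀ θ, HasDerivAt c (c' θ) θ) (h0 : c 0 = 1)
    (hb : ∀ θ, c' θ ^ 2 ≤ k ^ 2 * (1 - c θ ^ 2)) :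
    ∀ θ ∈ Set.Icc 0 Real.pi, Real.cos (Real.pi * (2 + k) / 3) ≤ c θ := by
  have hpi := Real.pi_pos
  -- The barrier is cos(k'θ + ε). A slope `k' > k` makes the comparison strict, and the shift ε > 0
  -- keeps the sine positive at θ = 0. The values put the argument at π(2 + k)/3 < π when θ = π.
  set k' := (1 + 2 * k) / 3 with hk'
  set ε := Real.pi * (1 - k) / 3 with hε
  have hkk : k < k' := by rw [hk']; linarith
  have hεp : 0 < ε := by rw [hε]; apply div_pos _ (by norm_num); exact mul_pos hpi (by linarith)
  have hend : k' * Real.pi + ε = Real.pi * (2 + k) / 3 := by rw [hk', hε]; ring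
  have hlt : Real.pi * (2 + k) / 3 < Real.pi := by nlinarith
  have hle : ∀ θ ∈ Set.Icc 0 Real.pi, k' * θ + ε ≤ Real.pi * (2 + k) / 3 := by
    intro θ hθ
    rw [← hend]
    have := mul_le_mul_of_nonneg_left hθ.2 (hk0.trans hkk.le)
    linarith
  have key : ∀ θ ∈ Set.Icc 0 Real.pi, -c θ ≤ -Real.cos (k' * θ + ε) := by
    have hB : ∀ x : ℝ, HasDerivAt (fun θ => -Real.cos (k' * θ + ε))
        (k' * Real.sin (k' * x + ε)) x := by
      intro x
      have h1 : HasDerivAt (fun θ : ℝ => k' * θ + ε) k' x := by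
        simpa using ((hasDerivAt_id x).const_mul k').add_const ε
      exact h1.cos.neg.congr_deriv (by ring)
    refine fun θ hθ => image_le_of_deriv_right_lt_deriv_boundary (f := fun θ => -c θ)
      (f' := fun θ => -c' θ) (a := 0) (b := Real.pi) ?_ ?_ ?_ hB ?_ hθ
    · exact fun x _ => (hc x).continuousAt.neg.continuousWithinAt
    · exact fun x _ => (hc x).neg.hasDerivWithinAt
    · simpa [h0] using Real.cos_le_one ε
    · intro x hx hxe
      have hcx : c x = Real.cos (k' * x + ε) := by linarith
      have hs : 0 < Real.sin (k' * x + ε) := by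
        apply Real.sin_pos_of_pos_of_lt_pi
        · have := mul_nonneg (hk0.trans hkk.le) hx.1
          linarith
        · exact (hle x ⟨hx.1, hx.2.le⟩).trans_lt hlt
      have h2 := hb x
      rw [hcx] at h2
      have h3 : 1 - Real.cos (k' * x + ε) ^ 2 = Real.sin (k' * x + ε) ^ 2 := by
        have := Real.sin_sq_add_cos_sq (k' * x + ε)
        linarith
      rw [h3, ← mul_pow] at h2
      have h4 := abs_le_of_sq_le_sq' h2 (by positivity)
      calc -c' x ≤ k * Real.sin (k' * x + ε) := by linarith [h4.1]
        _ < _ := by gcongr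
  intro θ hθ
  have h1 := key θ hθ
  have h2 : Real.cos (Real.pi * (2 + k) / 3) ≤ Real.cos (k' * θ + ε) := by
    apply Real.cos_le_cos_of_nonneg_of_le_pi _ hlt.le (hle θ hθ)
    have := mul_nonneg (hk0.trans hkk.le) hθ.1
    linarith
  linarith

/-- A bounded function on `ℝ` with `κ A² ≤ A'` is nonpositive. -/
theorem nonpos_of_mul_sq_le_deriv {A E : ℝ → ℝ} {κ B : ℝ} (hκ : 0 < κ)
    (hA : ∀ t, HasDerivAt A (E t) t) (hE : ∀ t, κ * A t ^ 2 ≤ E t) (hB : ∀ t, |A t| ≤ B) (t : ℝ) :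
    A t ≤ 0 := by
  by_contra! hpos
  have hmono : Monotone A := by
    apply monotone_of_deriv_nonneg (fun t => (hA t).differentiableAt)
    intro s
    rw [(hA s).deriv]
    exact (by positivity : 0 ≤ κ * A s ^ 2).trans (hE s)
  have hm : 0 < κ * A t ^ 2 := by positivity
  have hgrow : ∀ s, t ≤ s → κ * A t ^ 2 * (s - t) ≤ A s - A t := by
    intro s hs
    refine (convex_Ici t).mul_sub_le_image_sub_of_le_deriv
      (fun x _ => (hA x).continuousAt.continuousWithinAt)
      (fun x _ => (hA x).differentiableAt.differentiableWithinAt) ?_ t Set.self_mem_Ici s hs hs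
    intro x hx
    rw [interior_Ici] at hx
    rw [(hA x).deriv]
    refine le_trans ?_ (hE x)
    gcongr
    exact hmono (le_of_lt hx)
  have hB0 : 0 ≤ B := (abs_nonneg _).trans (hB t)
  -- By this time `A` has grown by at least `B + 1`, beyond its bound.
  have h1 := hgrow (t + (B + 1) / (κ * A t ^ 2)) (by simp; positivity)
  rw [add_sub_cancel_left, mul_div_cancel₀ _ hm.ne'] at h1
  have h2 := (le_abs_self _).trans (hB (t + (B + 1) / (κ * A t ^ 2)))
  linarith

/-- A bounded function on `ℝ` with `κ A² ≤ A'` vanishes. -/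
theorem eq_zero_of_mul_sq_le_deriv {A E : ℝ → ℝ} {κ B : ℝ} (hκ : 0 < κ)
    (hA : ∀ t, HasDerivAt A (E t) t) (hE : ∀ t, κ * A t ^ 2 ≤ E t) (hB : ∀ t, |A t| ≤ B) (t : ℝ) :
    A t = 0 := by
  apply le_antisymm (nonpos_of_mul_sq_le_deriv hκ hA hE hB t)
  -- The inequality is invariant under reversing both time and sign.
  have := nonpos_of_mul_sq_le_deriv (A := fun s => -A (-s)) (E := fun s => E (-s)) (B := B) hκ
    (fun s => ((hA (-s)).scomp s (hasDerivAt_neg s)).neg.congr_deriv (by simp))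
    (fun s => by simpa using hE (-s)) (fun s => by simpa using hB (-s)) (-t)
  simpa using this

/-! ### Lifts of a plane curve to affine charts -/

/-- Homogeneous coordinates of `g w`. -/
def homCoord {n : ℕ} (g : ↥(Set.univ : Set ℂ) → CProj n) (w : ℂ) : CSpace n :=
  (g ⟨w, Set.mem_univ _⟩).rep

/-- The representation of `g` normalized by `⟪a, F⟫ = 1`. -/
def normLift {n : ℕ} (g : ↥(Set.univ : Set ℂ) → CProj n) (a : CSpace n) (w : ℂ) : CSpace n :=
  (inner ℂ a (homCoord g w))⁻¹ • homCoord g w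

/-- The set of points where `g` avoids the hyperplane orthogonal to `a`. -/
def avoidSet {n : ℕ} (g : ↥(Set.univ : Set ℂ) → CProj n) (a : CSpace n) : Set ℂ :=
  {w | inner ℂ a (homCoord g w) ≠ 0}

section
variable {n : ℕ} {g : ↥(Set.univ : Set ℂ) → CProj n} {a b : CSpace n}

theorem homCoord_ne_zero (w : ℂ) : homCoord g w ≠ 0 := Projectivization.rep_nonzero _

theorem mk_homCoord (w : ℂ) :
    Projectivization.mk ℂ (homCoord g w) (homCoord_ne_zero w) = g ⟨w, Set.mem_univ _⟩ :=
  Projectivization.mk_rep _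

theorem exists_smul_eq_homCoord {F : ℂ → CSpace n} {U : Set ℂ} (hF : IsReducedRepOn g U F)
    {w : ℂ} (hw : w ∈ U) : ∃ c : ℂ, c ≠ 0 ∧ homCoord g w = c • F w := by
  obtain ⟨_, h0, e⟩ := hF.2 w hw
  obtain ⟨c, hc⟩ := Projectivization.exists_smul_eq_mk_rep ℂ (F w) h0
  exact ⟨c, c.ne_zero, by rw [homCoord, e, ← hc, Units.smul_def]⟩

/-- The representatives `homCoord g w` are chosen pointwise and need not be continuous in `w`. The
normalization cancels the arbitrary scalar, so `normLift` inherits holomorphy from any local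
representation. -/
theorem normLift_eq {F : ℂ → CSpace n} {U : Set ℂ} (hF : IsReducedRepOn g U F)
    {w : ℂ} (hw : w ∈ U) : normLift g a w = (inner ℂ a (F w))⁻¹ • F w := by
  obtain ⟨c, hc, e⟩ := exists_smul_eq_homCoord hF hw
  rw [normLift, e, inner_smul_right, smul_smul]
  congr 1
  field_simp

theorem mem_avoidSet_iff {F : ℂ → CSpace n} {U : Set ℂ} (hF : IsReducedRepOn g U F)
    {w : ℂ} (hw : w ∈ U) : w ∈ avoidSet g a ↔ inner ℂ a (F w) ≠ 0 := by
  obtain ⟨c, hc, e⟩ := exists_smul_eq_homCoord hF hw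
  rw [avoidSet, Set.mem_ofPred_eq, e, inner_smul_right]
  simp [hc]

theorem exists_isReducedRepOn (hg : IsHolomorphicCurve g) (w : ℂ) :
    ∃ F U, IsOpen U ∧ w ∈ U ∧ IsReducedRepOn g U F := by
  obtain ⟨F, U, h⟩ := hg ⟨w, Set.mem_univ _⟩
  exact ⟨F, U, h⟩

theorem isOpen_avoidSet (hg : IsHolomorphicCurve g) : IsOpen (avoidSet g a) := by
  rw [isOpen_iff_mem_nhds]
  intro w hw
  obtain ⟨F, U, hU, hwU, hF⟩ := exists_isReducedRepOn hg w
  have hc : ContinuousAt (fun z => inner ℂ a (F z)) w :=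
    continuousAt_const.inner (hF.1.differentiableAt (hU.mem_nhds hwU)).continuousAt
  filter_upwards [hU.mem_nhds hwU, hc.eventually_ne ((mem_avoidSet_iff hF hwU).1 hw)] with z hz hz'
  exact (mem_avoidSet_iff hF hz).2 hz'

theorem differentiableOn_normLift (hg : IsHolomorphicCurve g) :
    DifferentiableOn ℂ (normLift g a) (avoidSet g a) := by
  intro w hw
  apply DifferentiableAt.differentiableWithinAt
  obtain ⟨F, U, hU, hwU, hF⟩ := exists_isReducedRepOn hg w
  have hFw := hF.1.differentiableAt (hU.mem_nhds hwU)
  have hi : DifferentiableAt ℂ (fun z => inner ℂ a (F z)) w :=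
    (innerSL ℂ a).differentiableAt.comp w hFw
  refine ((hi.inv ((mem_avoidSet_iff hF hwU).1 hw)).smul hFw).congr_of_eventuallyEq ?_
  filter_upwards [hU.mem_nhds hwU] with z hz
  exact normLift_eq hF hz

theorem normLift_ne_zero {w : ℂ} (hw : w ∈ avoidSet g a) : normLift g a w ≠ 0 :=
  smul_ne_zero (inv_ne_zero hw) (homCoord_ne_zero w)

theorem isReducedRepOn_normLift (hg : IsHolomorphicCurve g) :
    IsReducedRepOn g (avoidSet g a) (normLift g a) := by
  refine ⟨differentiableOn_normLift hg, fun w hw => ⟨Set.mem_univ _, normLift_ne_zero hw, ?_⟩⟩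
  refine (mk_homCoord (g := g) w).symm.trans ?_
  rw [Projectivization.mk_eq_mk_iff']
  refine ⟨inner ℂ a (homCoord g w), ?_⟩
  rw [normLift, smul_smul, mul_inv_cancel₀ hw, one_smul]

theorem inner_normLift {w : ℂ} (hw : w ∈ avoidSet g a) : inner ℂ a (normLift g a w) = 1 := by
  rw [normLift, inner_smul_right, inv_mul_cancel₀ hw]

theorem hasDerivAt_normLift (hg : IsHolomorphicCurve g) {w : ℂ} (hw : w ∈ avoidSet g a) :
    HasDerivAt (normLift g a) (deriv (normLift g a) w) w :=
  ((differentiableOn_normLift hg).differentiableAt ((isOpen_avoidSet hg).mem_nhds hw)).hasDerivAt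

theorem differentiableOn_deriv_normLift (hg : IsHolomorphicCurve g) :
    DifferentiableOn ℂ (deriv (normLift g a)) (avoidSet g a) :=
  (differentiableOn_normLift hg).deriv (isOpen_avoidSet hg)

theorem inner_deriv_normLift (hg : IsHolomorphicCurve g) {w : ℂ} (hw : w ∈ avoidSet g a) :
    inner ℂ a (deriv (normLift g a) w) = 0 := by
  have h1 : HasDerivAt (fun z => inner ℂ a (normLift g a z))
      (inner ℂ a (deriv (normLift g a) w)) w :=
    (innerSL ℂ a).hasFDerivAt.comp_hasDerivAt w (hasDerivAt_normLift hg hw)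
  have h2 : HasDerivAt (fun z => inner ℂ a (normLift g a z)) 0 w := by
    refine (hasDerivAt_const w (1 : ℂ)).congr_of_eventuallyEq ?_
    filter_upwards [(isOpen_avoidSet hg).mem_nhds hw] with z hz
    exact inner_normLift hz
  exact h1.unique h2

theorem self_mem_avoidSet (w : ℂ) : w ∈ avoidSet g (homCoord g w) :=
  inner_self_ne_zero.2 (homCoord_ne_zero w)

end

/-! ### Energy density and distance from a point -/

/-- The square of the spherical derivative of `g`. -/
def energyDensity {n : ℕ} (g : ↥(Set.univ : Set ℂ) → CProj n) (w : ℂ) : ℝ :=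
  sphericalDeriv g ⟨w, Set.mem_univ _⟩ ^ 2

section
variable {n : ℕ} {g : ↥(Set.univ : Set ℂ) → CProj n} {a b : CSpace n}

theorem energyDensity_nonneg (w : ℂ) : 0 ≤ energyDensity g w := sq_nonneg _

theorem energyDensity_eq {F : ℂ → CSpace n} {U : Set ℂ} (hU : IsOpen U)
    (hF : IsReducedRepOn g U F) {w : ℂ} (hw : w ∈ U) :
    energyDensity g w
      = (‖F w‖ ^ 2 * ‖deriv F w‖ ^ 2 - ‖inner ℂ (F w) (deriv F w)‖ ^ 2) / ‖F w‖ ^ 4 := by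
  rw [energyDensity, sphericalDeriv_eq g ⟨w, Set.mem_univ _⟩ F ⟨U, hU, hw, hF⟩, fubiniStudyLength_sq]

theorem energyDensity_normLift (hg : IsHolomorphicCurve g) {w : ℂ} (hw : w ∈ avoidSet g a) :
    energyDensity g w = (‖normLift g a w‖ ^ 2 * ‖deriv (normLift g a) w‖ ^ 2
      - ‖inner ℂ (normLift g a w) (deriv (normLift g a) w)‖ ^ 2) / ‖normLift g a w‖ ^ 4 :=
  energyDensity_eq (isOpen_avoidSet hg) (isReducedRepOn_normLift hg) hw

theorem continuous_energyDensity (hg : IsHolomorphicCurve g) : Continuous (energyDensity g) := by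
  rw [continuous_iff_continuousAt]
  intro w
  obtain ⟨F, U, hU, hwU, hF⟩ := exists_isReducedRepOn hg w
  have hn := hU.mem_nhds hwU
  have h1 : ContinuousAt F w := (hF.1.differentiableAt hn).continuousAt
  have h2 : ContinuousAt (deriv F) w := ((hF.1.deriv hU).differentiableAt hn).continuousAt
  obtain ⟨_, h0, _⟩ := hF.2 w hwU
  have h3 : ContinuousAt (fun z => (‖F z‖ ^ 2 * ‖deriv F z‖ ^ 2
      - ‖inner ℂ (F z) (deriv F z)‖ ^ 2) / ‖F z‖ ^ 4) w := by
    refine ContinuousAt.div ?_ (h1.norm.pow 4) (by positivity)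
    exact ((h1.norm.pow 2).mul (h2.norm.pow 2)).sub ((h1.inner h2).norm.pow 2)
  refine h3.congr ?_
  filter_upwards [hn] with z hz
  exact (energyDensity_eq hU hF hz).symm

/-- The squared cosine of the Fubini--Study distance from `a` to `g w`. -/
def cosSqDist {n : ℕ} (g : ↥(Set.univ : Set ℂ) → CProj n) (a : CSpace n) (w : ℂ) : ℝ :=
  ‖inner ℂ a (homCoord g w)‖ ^ 2 / (‖a‖ ^ 2 * ‖homCoord g w‖ ^ 2)

theorem cosSqDist_eq {F : ℂ → CSpace n} {U : Set ℂ} (hF : IsReducedRepOn g U F)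
    {w : ℂ} (hw : w ∈ U) :
    cosSqDist g a w = ‖inner ℂ a (F w)‖ ^ 2 / (‖a‖ ^ 2 * ‖F w‖ ^ 2) := by
  obtain ⟨c, hc, e⟩ := exists_smul_eq_homCoord hF hw
  have : ‖c‖ ≠ 0 := norm_ne_zero_iff.2 hc
  rw [cosSqDist, e, inner_smul_right, norm_mul, norm_smul, mul_pow, mul_pow, mul_left_comm,
    mul_div_mul_left _ _ (pow_ne_zero 2 this)]

theorem real_inner_eq_re {n : ℕ} (ζ v : CSpace n) : inner ℝ ζ v = (inner ℂ ζ v).re := by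
  simp [PiLp.inner_apply, Complex.inner]

theorem hasDerivAt_lineComp {V : Type*} [NormedAddCommGroup V] [NormedSpace ℂ V] {F : ℂ → V}
    {F' : V} {u : ℂ} {w : ℂ} {s : ℝ} (hF : HasDerivAt F F' (w + s * u)) :
    HasDerivAt (fun r : ℝ => F (w + r * u)) (u • F') s := by
  have h1 : HasDerivAt (fun r : ℝ => w + r * u) u s := by
    simpa using ((Complex.ofRealCLM.hasDerivAt (x := s)).mul_const u).const_add w
  exact HasDerivAt.scomp (𝕜' := ℂ) s hF h1

/-- Along a unit-speed line the distance d to `a` changes at rate at most `g^#`; for x = cos² d this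
reads x'² ≤ 4x(1 - x)(g^#)². Unlike d itself, x is differentiable everywhere, including where d is 0
or π/2. -/
theorem exists_hasDerivAt_cosSqDist (hg : IsHolomorphicCurve g) (ha : a ≠ 0) (w u : ℂ) (s : ℝ)
    (hu : ‖u‖ = 1) :
    ∃ x' : ℝ, HasDerivAt (fun r : ℝ => cosSqDist g a (w + r * u)) x' s ∧
      x' ^ 2 ≤ 4 * cosSqDist g a (w + s * u) * (1 - cosSqDist g a (w + s * u))
        * energyDensity g (w + s * u) := by
  obtain ⟨F, U, hU, hwU, hF⟩ := exists_isReducedRepOn hg (w + s * u)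
  have hn := hU.mem_nhds hwU
  have hFd := (hF.1.differentiableAt hn).hasDerivAt
  rw [energyDensity_eq hU hF hwU, cosSqDist_eq hF hwU]
  obtain ⟨_, h0, _⟩ := hF.2 _ hwU
  have hcont : ContinuousAt (fun r : ℝ => w + r * u) s := by fun_prop
  have hev : (fun r : ℝ => cosSqDist g a (w + r * u)) =ᶠ[𝓝 s] fun r : ℝ =>
      ‖inner ℂ a (F (w + r * u))‖ ^ 2 / (‖a‖ ^ 2 * ‖F (w + r * u)‖ ^ 2) := by
    filter_upwards [hcont hn] with r hr
    exact cosSqDist_eq hF hr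
  have hl := hasDerivAt_lineComp hFd
  have hq : HasDerivAt (fun r : ℝ => inner ℂ a (F (w + r * u)))
      (inner ℂ a (u • deriv F (w + s * u))) s := by
    simpa only [inner_zero_left, add_zero] using (hasDerivAt_const s a).inner ℂ hl
  have hx := hq.norm_sq.div (hl.norm_sq.const_mul (‖a‖ ^ 2))
    (by positivity : ‖a‖ ^ 2 * ‖F (w + s * u)‖ ^ 2 ≠ 0)
  refine ⟨_, hx.congr_of_eventuallyEq hev, ?_⟩
  have hv : ‖F (w + s * u)‖ ^ 2 * ‖deriv F (w + s * u)‖ ^ 2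
        - ‖inner ℂ (F (w + s * u)) (deriv F (w + s * u))‖ ^ 2
      = ‖F (w + s * u)‖ ^ 2 * ‖u • deriv F (w + s * u)‖ ^ 2
        - ‖inner ℂ (F (w + s * u)) (u • deriv F (w + s * u))‖ ^ 2 := by
    rw [norm_smul, inner_smul_right, norm_mul, hu, one_mul, one_mul]
  rw [hv]
  generalize u • deriv F (w + s * u) = v at *
  generalize F (w + s * u) = ζ at *
  have key := norm_sq_inner_orthogonal_le a v ζ h0
  rw [Complex.inner, real_inner_eq_re, mul_comm (inner ℂ a v)]
  set q := inner ℂ a ζ with hqdef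
  have hN : 0 < ‖ζ‖ := norm_pos_iff.2 h0
  have hA : 0 < ‖a‖ := norm_pos_iff.2 ha
  -- The numerator from the quotient rule, regrouped so that only the components of `a` and `v`
  -- orthogonal to `ζ` enter; `key` then bounds it.
  have hre : 2 * (starRingEnd ℂ q * inner ℂ a v).re * (‖a‖ ^ 2 * ‖ζ‖ ^ 2)
      - ‖q‖ ^ 2 * (‖a‖ ^ 2 * (2 * (inner ℂ ζ v).re))
      = 2 * ‖a‖ ^ 2 * (starRingEnd ℂ q *
          ((‖ζ‖ ^ 2 : ℂ) * inner ℂ a v - q * inner ℂ ζ v)).re := by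
    have : starRingEnd ℂ q * ((‖ζ‖ ^ 2 : ℂ) * inner ℂ a v - q * inner ℂ ζ v)
        = ((‖ζ‖ ^ 2 : ℝ) : ℂ) * (starRingEnd ℂ q * inner ℂ a v)
          - ((‖q‖ ^ 2 : ℝ) : ℂ) * inner ℂ ζ v := by
      push_cast
      rw [← Complex.conj_mul' q]
      ring
    rw [this, Complex.sub_re, Complex.re_ofReal_mul, Complex.re_ofReal_mul]
    ring
  have hle : (starRingEnd ℂ q * ((‖ζ‖ ^ 2 : ℂ) * inner ℂ a v - q * inner ℂ ζ v)).re ^ 2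
      ≤ ‖q‖ ^ 2 * ((‖ζ‖ ^ 2 * ‖a‖ ^ 2 - ‖q‖ ^ 2) *
        (‖ζ‖ ^ 2 * ‖v‖ ^ 2 - ‖inner ℂ ζ v‖ ^ 2)) := by
    calc _ ≤ ‖starRingEnd ℂ q * ((‖ζ‖ ^ 2 : ℂ) * inner ℂ a v - q * inner ℂ ζ v)‖ ^ 2 := by
          rw [← sq_abs]
          gcongr
          exact Complex.abs_re_le_norm _
      _ = ‖q‖ ^ 2 * ‖(‖ζ‖ ^ 2 : ℂ) * inner ℂ a v - q * inner ℂ ζ v‖ ^ 2 := by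
          rw [norm_mul, mul_pow, RCLike.norm_conj]
      _ ≤ _ := by gcongr
  rw [hre]
  have e1 : ∀ X : ℝ, (2 * ‖a‖ ^ 2 * X / (‖a‖ ^ 2 * ‖ζ‖ ^ 2) ^ 2) ^ 2
      = 4 / (‖a‖ ^ 4 * ‖ζ‖ ^ 8) * X ^ 2 := by
    intro X; field_simp; ring
  have e2 : 4 * (‖q‖ ^ 2 / (‖a‖ ^ 2 * ‖ζ‖ ^ 2)) * (1 - ‖q‖ ^ 2 / (‖a‖ ^ 2 * ‖ζ‖ ^ 2))
      * ((‖ζ‖ ^ 2 * ‖v‖ ^ 2 - ‖inner ℂ ζ v‖ ^ 2) / ‖ζ‖ ^ 4)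
      = 4 / (‖a‖ ^ 4 * ‖ζ‖ ^ 8) * (‖q‖ ^ 2 * ((‖ζ‖ ^ 2 * ‖a‖ ^ 2 - ‖q‖ ^ 2) *
        (‖ζ‖ ^ 2 * ‖v‖ ^ 2 - ‖inner ℂ ζ v‖ ^ 2))) := by
    field_simp
  rw [e1, e2]
  gcongr

theorem cosSqDist_nonneg (w : ℂ) : 0 ≤ cosSqDist g a w := by
  unfold cosSqDist; positivity

theorem cosSqDist_le_one (w : ℂ) : cosSqDist g a w ≤ 1 := by
  unfold cosSqDist
  refine div_le_one_of_le₀ ?_ (by positivity)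
  rw [← mul_pow]
  gcongr
  exact norm_inner_le_norm _ _

/-- If the spherical derivative is at most `K < 1/2`, then segments of length `π` are mapped to
balls of radius less than `π / 2` around the image of an endpoint. -/
theorem le_cosSqDist (hg : IsHolomorphicCurve g) {K : ℝ} (hK0 : 0 ≤ K) (hK : K < 1 / 2)
    (hS : ∀ w, energyDensity g w ≤ K ^ 2) (w u : ℂ) (hu : ‖u‖ = 1) {s : ℝ}
    (hs : s ∈ Set.Icc 0 Real.pi) :
    (1 + Real.cos (Real.pi * (2 + 2 * K) / 3)) / 2
      ≤ cosSqDist g (homCoord g w) (w + s * u) := by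
  have ha : homCoord g w ≠ 0 := homCoord_ne_zero w
  choose x' hx' hle using fun r : ℝ => exists_hasDerivAt_cosSqDist hg ha w u r hu
  -- With d the distance from `g w`, the function c is cos 2d = 2cos² d - 1, and 2d grows at rate at
  -- most 2K. The hypothesis K < 1/2 is what makes this rate less than 1.
  have h := cos_le_of_deriv_sq_le (k := 2 * K)
    (c := fun r : ℝ => 2 * cosSqDist g (homCoord g w) (w + r * u) - 1)
    (c' := fun r => 2 * x' r) (by linarith) (by linarith)
    (fun r => ((hx' r).const_mul 2).sub_const 1) ?_ ?_ s hs
  · linarith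
  · have : ‖homCoord g w‖ ≠ 0 := norm_ne_zero_iff.2 ha
    have h1 : cosSqDist g (homCoord g w) w = 1 := by
      rw [cosSqDist, inner_self_eq_norm_sq_to_K, norm_pow]
      simp only [Complex.coe_algebraMap, Complex.norm_real, norm_norm]
      field_simp
    simp only [Complex.ofReal_zero, zero_mul, add_zero, h1]
    norm_num
  · intro r
    have h1 := hle r
    have h2 := hS (w + r * u)
    have h3 := cosSqDist_nonneg (g := g) (a := homCoord g w) (w + r * u)
    have h4 := cosSqDist_le_one (g := g) (a := homCoord g w) (w + r * u)
    have h5 := mul_le_mul_of_nonneg_left h2 (mul_nonneg (mul_nonneg zero_le_four h3)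
      (sub_nonneg.2 h4))
    nlinarith

end

/-! ### The connection form and Stokes' formula -/

/-- The connection form `∂ log ‖F‖²` of the representation `F` of `g` normalized by
`⟪a, F⟫ = 1`. -/
def connForm {n : ℕ} (g : ↥(Set.univ : Set ℂ) → CProj n) (a : CSpace n) (w : ℂ) : ℂ :=
  inner ℂ (normLift g a w) (deriv (normLift g a) w) / inner ℂ (normLift g a w) (normLift g a w)

section
variable {n : ℕ} {g : ↥(Set.univ : Set ℂ) → CProj n} {a b : CSpace n}

theorem continuousOn_connForm (hg : IsHolomorphicCurve g) :
    ContinuousOn (connForm g a) (avoidSet g a) := by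
  have h1 := (differentiableOn_normLift (a := a) hg).continuousOn
  have h2 := (differentiableOn_deriv_normLift (a := a) hg).continuousOn
  exact (h1.inner h2).div (h1.inner h1) fun w hw => inner_self_ne_zero.2 (normLift_ne_zero hw)

/-- As ⟪a, F⟫ = 1 and ⟪a, F'⟫ = 0, Cauchy–Schwarz orthogonally to `F` bounds the connection form by
tan d · `g^#`, where d is the distance to `a`. Multiplying by cos d and dropping sin d ≤ 1 leaves
the estimate behind the isoperimetric inequality. -/
theorem norm_sq_connForm_le (hg : IsHolomorphicCurve g) {w : ℂ} (hw : w ∈ avoidSet g a) :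
    cosSqDist g a w * ‖connForm g a w‖ ^ 2 ≤ energyDensity g w := by
  have h0 := normLift_ne_zero hw
  have key := norm_sq_inner_orthogonal_le a (deriv (normLift g a) w) (normLift g a w) h0
  rw [inner_deriv_normLift hg hw, inner_normLift hw] at key
  rw [energyDensity_normLift hg hw, cosSqDist_eq (isReducedRepOn_normLift hg) hw,
    inner_normLift hw, connForm, norm_div, inner_self_eq_norm_sq_to_K, norm_pow]
  have ha : a ≠ 0 := by
    rintro rfl
    simp [avoidSet] at hw
  simp only [mul_zero, zero_sub, norm_neg, one_mul, norm_one, one_pow, Complex.coe_algebraMap,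
    Complex.norm_real, norm_norm] at key ⊢
  generalize deriv (normLift g a) w = v at *
  generalize normLift g a w = ζ at *
  have hN : 0 < ‖ζ‖ := norm_pos_iff.2 h0
  have hA : 0 < ‖a‖ := norm_pos_iff.2 ha
  have hD : 0 ≤ ‖ζ‖ ^ 2 * ‖v‖ ^ 2 - ‖inner ℂ ζ v‖ ^ 2 := by
    have := pow_le_pow_left₀ (norm_nonneg _) (norm_inner_le_norm (𝕜 := ℂ) ζ v) 2
    rw [mul_pow] at this
    linarith
  rw [div_pow, div_mul_div_comm, one_mul, div_le_div_iff₀ (by positivity) (by positivity)]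
  have h2 : ‖inner ℂ ζ v‖ ^ 2
      ≤ ‖ζ‖ ^ 2 * ‖a‖ ^ 2 * (‖ζ‖ ^ 2 * ‖v‖ ^ 2 - ‖inner ℂ ζ v‖ ^ 2) := by
    refine key.trans ?_
    gcongr
    linarith
  calc _ ≤ ‖ζ‖ ^ 2 * ‖a‖ ^ 2 * (‖ζ‖ ^ 2 * ‖v‖ ^ 2 - ‖inner ℂ ζ v‖ ^ 2) * ‖ζ‖ ^ 4 := by gcongr
    _ = _ := by ring

/-- The `∂̄`-derivative of the connection form is the energy density. -/
theorem hasFDerivAt_connForm (hg : IsHolomorphicCurve g) {w : ℂ} (hw : w ∈ avoidSet g a) :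
    HasFDerivAt (𝕜 := ℝ) (connForm g a) (fderiv ℝ (connForm g a) w) w ∧
      I • fderiv ℝ (connForm g a) w 1 - fderiv ℝ (connForm g a) w I
        = I * (2 * energyDensity g w : ℝ) := by
  have hn := (isOpen_avoidSet hg).mem_nhds hw
  have h1 := hasDerivAt_normLift hg hw
  have h2 := ((differentiableOn_deriv_normLift hg).differentiableAt hn).hasDerivAt
  have h0 := normLift_ne_zero hw
  have h0' : inner ℂ (normLift g a w) (normLift g a w) ≠ 0 := inner_self_ne_zero.2 h0
  have hdiff : DifferentiableAt ℝ (connForm g a) w := by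
    have r1 := h1.differentiableAt.restrictScalars ℝ
    have r2 := h2.differentiableAt.restrictScalars ℝ
    have r3 : DifferentiableAt ℝ (fun z => (inner ℂ (normLift g a z) (normLift g a z))⁻¹) w :=
      (r1.inner ℂ r1).fun_inv h0'
    exact ((r1.inner ℂ r2).fun_mul r3).congr_of_eventuallyEq
      (Eventually.of_forall fun z => div_eq_mul_inv _ _)
  refine ⟨hdiff.hasFDerivAt, ?_⟩
  -- Terms with `u` in the right slot of an inner product are linear in `u` and cancel in `I • ∂₁ -
  -- ∂_I`; those with `u` in the left slot are conjugate linear and are doubled.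
  have hline : ∀ u : ℂ, fderiv ℝ (connForm g a) w u =
      ((inner ℂ (normLift g a w) (u • deriv (deriv (normLift g a)) w)
        + inner ℂ (u • deriv (normLift g a) w) (deriv (normLift g a) w))
        * inner ℂ (normLift g a w) (normLift g a w)
      - inner ℂ (normLift g a w) (deriv (normLift g a) w)
        * (inner ℂ (normLift g a w) (u • deriv (normLift g a) w)
          + inner ℂ (u • deriv (normLift g a) w) (normLift g a w)))
      / inner ℂ (normLift g a w) (normLift g a w) ^ 2 := by
    intro u
    have hw0 : w + ((0 : ℝ) : ℂ) * u = w := by simp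
    have l1 := hasDerivAt_lineComp (u := u) (s := 0) (w := w) (by rw [hw0]; exact h1)
    have l2 := hasDerivAt_lineComp (u := u) (s := 0) (w := w) (by rw [hw0]; exact h2)
    have l3 := (l1.inner ℂ l2).div (l1.inner ℂ l1) (by rw [hw0]; exact h0')
    rw [hw0] at l3
    have l4 : HasDerivAt (fun r : ℝ => w + r * u) u 0 := by
      simpa using ((Complex.ofRealCLM.hasDerivAt (x := 0)).mul_const u).const_add w
    have l5 := HasFDerivAt.comp_hasDerivAt (l := connForm g a) (0 : ℝ)
      (by rw [hw0]; exact hdiff.hasFDerivAt) l4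
    exact l5.unique l3
  rw [hline, hline, energyDensity_normLift hg hw]
  generalize deriv (deriv (normLift g a)) w = v' at *
  generalize deriv (normLift g a) w = v at *
  generalize normLift g a w = ζ at *
  have hN : (‖ζ‖ : ℂ) ≠ 0 := by exact_mod_cast norm_ne_zero_iff.2 h0
  push_cast
  rw [← Complex.mul_conj' (inner ℂ ζ v), inner_conj_symm]
  simp only [inner_smul_left, inner_smul_right, inner_self_eq_norm_sq_to_K, map_one,
    Complex.conj_I, Complex.coe_algebraMap, smul_eq_mul]
  field_simp
  ring

/-- Stokes' formula for the connection form on a rectangle of height equal to the period. -/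
theorem integral_connForm_sub (hg : IsHolomorphicCurve g)
    (hper : ∀ w, homCoord g (w + 2 * Real.pi * I) = homCoord g w) {t₁ t₂ : ℝ}
    (h : ∀ t ∈ Set.uIcc t₁ t₂, ∀ θ ∈ Set.Icc (-Real.pi) Real.pi, (t + θ * I : ℂ) ∈ avoidSet g a) :
    (∫ θ in (-Real.pi)..Real.pi, connForm g a (t₂ + θ * I))
      - ∫ θ in (-Real.pi)..Real.pi, connForm g a (t₁ + θ * I)
      = ((2 * ∫ t in t₁..t₂, ∫ θ in (-Real.pi)..Real.pi, energyDensity g (t + θ * I) : ℝ) : ℂ) := by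
  have hpi := Real.pi_pos
  have hsub : (Set.uIcc t₁ t₂ ×ℂ Set.uIcc (-Real.pi) Real.pi) ⊆ avoidSet g a := by
    intro z hz
    rw [Complex.mem_reProdIm, Set.uIcc_of_le (by linarith : -Real.pi ≤ Real.pi)] at hz
    simpa [Complex.re_add_im] using h z.re hz.1 z.im hz.2
  have hperP : ∀ w, connForm g a (w + 2 * Real.pi * I) = connForm g a w := by
    have h1 : ∀ w, normLift g a (w + 2 * Real.pi * I) = normLift g a w := by
      intro w
      rw [normLift, normLift, hper]
    have h2 : ∀ w, deriv (normLift g a) (w + 2 * Real.pi * I) = deriv (normLift g a) w := by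
      intro w
      rw [← deriv_comp_add_const]
      simp only [h1]
    intro w
    rw [connForm, connForm, h1, h2]
  have hrect := Complex.integral_boundary_rect_of_hasFDerivAt_real_off_countable (connForm g a)
    (fderiv ℝ (connForm g a)) (t₁ + (-Real.pi : ℝ) * I) (t₂ + (Real.pi : ℝ) * I) ∅
    Set.countable_empty
  simp only [Complex.add_re, Complex.ofReal_re, Complex.re_ofReal_mul, Complex.I_re, mul_zero,
    add_zero, Complex.add_im, Complex.ofReal_im, Complex.im_ofReal_mul, Complex.I_im, mul_one,
    zero_add] at hrect
  have hcompact : IsCompact (Set.uIcc t₁ t₂ ×ℂ Set.uIcc (-Real.pi) Real.pi) :=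
    isCompact_uIcc.reProdIm isCompact_uIcc
  specialize hrect ((continuousOn_connForm hg).mono hsub) ?_ ?_
  · intro x hx
    refine (hasFDerivAt_connForm hg (hsub ?_)).1
    have := hx.1
    rw [Complex.mem_reProdIm] at this ⊢
    exact ⟨Set.Ioo_subset_Icc_self this.1, Set.Ioo_subset_Icc_self this.2⟩
  · have hc : Continuous fun w => I * ((2 * energyDensity g w : ℝ) : ℂ) := by
      have := continuous_energyDensity hg
      fun_prop
    refine (hc.continuousOn.integrableOn_compact hcompact).congr_fun ?_ hcompact.measurableSet
    intro w hw
    exact (hasFDerivAt_connForm hg (hsub hw)).2.symm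
  -- By periodicity the two horizontal edges of the rectangle cancel.
  have hedge : ∀ x : ℝ, connForm g a (x + (Real.pi : ℝ) * I)
      = connForm g a (x + (-Real.pi : ℝ) * I) := by
    intro x
    rw [← hperP (x + (-Real.pi : ℝ) * I)]
    congr 1
    push_cast
    ring
  have hright : (∫ t in t₁..t₂, ∫ θ in (-Real.pi)..Real.pi,
      (I • fderiv ℝ (connForm g a) (t + θ * I) 1 - fderiv ℝ (connForm g a) (t + θ * I) I))
      = I * ((2 * ∫ t in t₁..t₂, ∫ θ in (-Real.pi)..Real.pi,
        energyDensity g (t + θ * I) : ℝ) : ℂ) := by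
    have : ∀ t ∈ Set.uIcc t₁ t₂, (∫ θ in (-Real.pi)..Real.pi,
      (I • fderiv ℝ (connForm g a) (t + θ * I) 1 - fderiv ℝ (connForm g a) (t + θ * I) I))
        = I * ((2 * ∫ θ in (-Real.pi)..Real.pi, energyDensity g (t + θ * I) : ℝ) : ℂ) := by
      intro t ht
      rw [← intervalIntegral.integral_const_mul, ← intervalIntegral.integral_ofReal,
        ← intervalIntegral.integral_const_mul]
      refine intervalIntegral.integral_congr fun θ hθ => ?_
      rw [Set.uIcc_of_le (by linarith : -Real.pi ≤ Real.pi)] at hθ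
      exact (hasFDerivAt_connForm hg (h t ht θ hθ)).2
    rw [intervalIntegral.integral_congr this, intervalIntegral.integral_const_mul,
      intervalIntegral.integral_ofReal, intervalIntegral.integral_const_mul]
  rw [hright] at hrect
  simp only [hedge, sub_self, zero_add, smul_eq_mul] at hrect
  rw [← mul_sub] at hrect
  exact mul_left_cancel₀ Complex.I_ne_zero hrect

/-- The integral of the connection form over a period does not change if the normalizing vector
`a` is replaced by `b`, provided that `⟪b, F⟫` stays in a half-plane. -/
theorem integral_connForm_eq (hg : IsHolomorphicCurve g)
    (hper : ∀ w, homCoord g (w + 2 * Real.pi * I) = homCoord g w) {t : ℝ} {k : ℂ}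
    (h : ∀ θ ∈ Set.Icc (-Real.pi) Real.pi, (t + θ * I : ℂ) ∈ avoidSet g a)
    (hk : ∀ θ ∈ Set.Icc (-Real.pi) Real.pi, 0 < (k * inner ℂ b (normLift g a (t + θ * I))).re) :
    ∫ θ in (-Real.pi)..Real.pi, connForm g b (t + θ * I)
      = ∫ θ in (-Real.pi)..Real.pi, connForm g a (t + θ * I) := by
  have hpi := Real.pi_pos
  have hle : -Real.pi ≤ Real.pi := by linarith
  have hk0 : k ≠ 0 := by
    rintro rfl
    simpa using hk 0 ⟨by linarith, hpi.le⟩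
  have hb : ∀ θ ∈ Set.Icc (-Real.pi) Real.pi, inner ℂ b (normLift g a (t + θ * I)) ≠ 0 := by
    intro θ hθ h0
    simpa [h0] using hk θ hθ
  -- The lift for `b` is F/⟪b, F⟫ with F the lift for `a`; ∂ log of its squared norm loses exactly
  -- the logarithmic derivative of ⟪b, F⟫, the conjugate factor being antiholomorphic.
  have hP : ∀ w ∈ avoidSet g a, inner ℂ b (normLift g a w) ≠ 0 →
      connForm g b w = connForm g a w
        - inner ℂ b (deriv (normLift g a) w) / inner ℂ b (normLift g a w) := by
    intro w hw hbw
    have h1 := hasDerivAt_normLift hg hw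
    have h2 : HasDerivAt (fun z => inner ℂ b (normLift g a z))
        (inner ℂ b (deriv (normLift g a) w)) w :=
      (innerSL ℂ b).hasFDerivAt.comp_hasDerivAt w h1
    have h3 : HasDerivAt (normLift g b) _ w :=
      ((h2.fun_inv hbw).fun_smul h1).congr_of_eventuallyEq (by
        filter_upwards [(isOpen_avoidSet hg).mem_nhds hw] with z hz
        exact normLift_eq (isReducedRepOn_normLift hg) hz)
    have h0 : inner ℂ (normLift g a w) (normLift g a w) ≠ 0 :=
      inner_self_ne_zero.2 (normLift_ne_zero hw)
    have hc : starRingEnd ℂ (inner ℂ b (normLift g a w)) ≠ 0 := (map_ne_zero _).2 hbw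
    rw [connForm, h3.deriv, normLift_eq (isReducedRepOn_normLift hg) hw, connForm]
    simp only [inner_smul_left, inner_smul_right, inner_add_right, map_inv₀]
    field_simp
    ring
  have hmem : ∀ θ ∈ Set.uIcc (-Real.pi) Real.pi, θ ∈ Set.Icc (-Real.pi) Real.pi := by
    intro θ hθ
    rwa [Set.uIcc_of_le hle] at hθ
  rw [intervalIntegral.integral_congr fun θ hθ => hP _ (h θ (hmem θ hθ)) (hb θ (hmem θ hθ))]
  have hmaps : Set.MapsTo (fun θ : ℝ => (t + θ * I : ℂ)) (Set.uIcc (-Real.pi) Real.pi)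
      (avoidSet g a) := fun θ hθ => h θ (hmem θ hθ)
  have hlc : ContinuousOn (fun θ : ℝ => (t + θ * I : ℂ)) (Set.uIcc (-Real.pi) Real.pi) := by
    fun_prop
  have c1 : ContinuousOn (fun θ : ℝ => connForm g a (t + θ * I))
      (Set.uIcc (-Real.pi) Real.pi) := (continuousOn_connForm hg).comp hlc hmaps
  have c2 : ContinuousOn (fun θ : ℝ => inner ℂ b (deriv (normLift g a) (t + θ * I))
      / inner ℂ b (normLift g a (t + θ * I))) (Set.uIcc (-Real.pi) Real.pi) := by
    have d1 := (differentiableOn_normLift (a := a) hg).continuousOn.comp hlc hmaps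
    have d2 := (differentiableOn_deriv_normLift (a := a) hg).continuousOn.comp hlc hmaps
    exact (continuousOn_const.inner d2).div (continuousOn_const.inner d1)
      fun θ hθ => hb θ (hmem θ hθ)
  rw [intervalIntegral.integral_sub c1.intervalIntegrable c2.intervalIntegrable, sub_eq_self]
  -- In the right half-plane the principal logarithm of k⟪b, F⟫ is a primitive, and it takes equal
  -- values at both ends of the period.
  have hlog := intervalIntegral.integral_eq_sub_of_hasDerivAt
    (f := fun θ : ℝ => Complex.log (k * inner ℂ b (normLift g a (t + θ * I))))
    (f' := fun θ : ℝ => I * (inner ℂ b (deriv (normLift g a) (t + θ * I))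
      / inner ℂ b (normLift g a (t + θ * I)))) (a := -Real.pi) (b := Real.pi) ?_
    (continuousOn_const.mul c2).intervalIntegrable
  · have hend : normLift g a (t + (Real.pi : ℝ) * I)
        = normLift g a (t + ((-Real.pi : ℝ) : ℂ) * I) := by
      have : (t + (Real.pi : ℝ) * I : ℂ) = (t + ((-Real.pi : ℝ) : ℂ) * I) + 2 * Real.pi * I := by
        push_cast
        ring
      rw [this, normLift, hper, normLift]
    rw [hend, sub_self, intervalIntegral.integral_const_mul] at hlog
    exact (mul_eq_zero.1 hlog).resolve_left Complex.I_ne_zero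
  · intro θ hθ
    have hθ' := hmem θ hθ
    have h1 := hasDerivAt_lineComp (hasDerivAt_normLift hg (h θ hθ'))
    have h2 : HasDerivAt (fun r : ℝ => inner ℂ b (normLift g a (t + r * I)))
        (inner ℂ b (I • deriv (normLift g a) (t + θ * I))) θ := by
      simpa only [inner_zero_left, add_zero] using (hasDerivAt_const θ b).inner ℂ h1
    have h3 := (h2.const_mul k).clog_real (Or.inl (hk θ hθ'))
    refine h3.congr_deriv ?_
    have := hb θ hθ'
    rw [inner_smul_right]
    field_simp

end

/-! ### Enclosed area: growth and isoperimetry -/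

/-- The integral of the energy density of `g` over the vertical segment `t + i[-π, π]`. -/
def circleEnergy {n : ℕ} (g : ↥(Set.univ : Set ℂ) → CProj n) (t : ℝ) : ℝ :=
  ∫ θ in (-Real.pi)..Real.pi, energyDensity g (t + θ * I)

/-- The area enclosed by the image of the vertical segment `t + i[-π, π]`, for a curve of period
`2πi` with short images of these segments. -/
def enclosedArea {n : ℕ} (g : ↥(Set.univ : Set ℂ) → CProj n) (t : ℝ) : ℝ :=
  (∫ θ in (-Real.pi)..Real.pi, connForm g (homCoord g t) (t + θ * I)).re / 2

section
variable {n : ℕ} {g : ↥(Set.univ : Set ℂ) → CProj n} {a b : CSpace n}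

theorem continuous_circleEnergy (hg : IsHolomorphicCurve g) : Continuous (circleEnergy g) := by
  have := continuous_energyDensity hg
  exact intervalIntegral.continuous_parametric_intervalIntegral_of_continuous'
    (f := fun (t θ : ℝ) => energyDensity g (t + θ * I)) (by fun_prop) _ _

/-- The area enclosed by the images of the segments grows at the rate of their energy. -/
theorem hasDerivAt_enclosedArea (hg : IsHolomorphicCurve g)
    (hper : ∀ w, homCoord g (w + 2 * Real.pi * I) = homCoord g w)
    (havoid : ∀ t : ℝ, ∀ θ ∈ Set.Icc (-Real.pi) Real.pi,
      (t + θ * I : ℂ) ∈ avoidSet g (homCoord g t)) (t₀ : ℝ) :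
    HasDerivAt (enclosedArea g) (circleEnergy g t₀) t₀ := by
  set a := homCoord g t₀ with ha
  have ha0 : a ≠ 0 := homCoord_ne_zero _
  have hlift : normLift g a t₀ = (inner ℂ a a)⁻¹ • a := rfl
  -- `enclosedArea` normalizes by a vector moving with `t`, whereas Stokes needs a fixed one. The
  -- second condition permits the change of vector: at t₀ the inner product is the positive number
  -- 1/‖a‖², and compactness of the segment keeps its real part positive nearby.
  have hev : ∀ᶠ t : ℝ in 𝓝 t₀, ∀ θ ∈ Set.Icc (-Real.pi) Real.pi,
      (t + θ * I : ℂ) ∈ avoidSet g a ∧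
        0 < (inner ℂ (normLift g a t) (normLift g a (t + θ * I))).re := by
    refine isCompact_Icc.eventually_forall_of_forall_eventually fun θ hθ => ?_
    have hw := havoid t₀ θ hθ
    have hc1 : ContinuousAt (fun z : ℝ × ℝ => (z.1 + z.2 * I : ℂ)) (t₀, θ) := by fun_prop
    have hc2 : ContinuousAt (fun z : ℝ × ℝ => (z.1 : ℂ)) (t₀, θ) := by fun_prop
    have d : ∀ w ∈ avoidSet g a, ContinuousAt (normLift g a) w :=
      fun w hw => (hasDerivAt_normLift hg hw).continuousAt
    have e1 : ContinuousAt (fun z : ℝ × ℝ => normLift g a (z.1 + z.2 * I)) (t₀, θ) :=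
      ContinuousAt.comp (g := normLift g a) (d _ hw) hc1
    have e2 : ContinuousAt (fun z : ℝ × ℝ => normLift g a z.1) (t₀, θ) :=
      ContinuousAt.comp (g := normLift g a) (d _ (self_mem_avoidSet _)) hc2
    have e3 : ContinuousAt (fun z : ℝ × ℝ =>
        (inner ℂ (normLift g a z.1) (normLift g a (z.1 + z.2 * I))).re) (t₀, θ) :=
      Complex.continuous_re.continuousAt.comp (e2.inner e1)
    have hpos : 0 < (inner ℂ (normLift g a t₀) (normLift g a (t₀ + θ * I))).re := by
      rw [hlift, inner_smul_left, inner_normLift hw, mul_one, inner_self_eq_norm_sq_to_K]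
      simp only [Complex.coe_algebraMap, ← Complex.ofReal_pow, ← Complex.ofReal_inv,
        Complex.conj_ofReal, Complex.ofReal_re]
      positivity
    exact (hc1.eventually_mem ((isOpen_avoidSet hg).mem_nhds hw)).and
      (e3.eventually (lt_mem_nhds hpos))
  obtain ⟨δ, hδ, hball⟩ := Metric.eventually_nhds_iff_ball.1 hev
  have hmain : ∀ t ∈ Metric.ball t₀ δ,
      enclosedArea g t = enclosedArea g t₀ + ∫ s in t₀..t, circleEnergy g s := by
    intro t ht
    have hseg : ∀ s ∈ Set.uIcc t₀ t, s ∈ Metric.ball t₀ δ := by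
      intro s hs
      exact (convex_ball t₀ δ).ordConnected.uIcc_subset (Metric.mem_ball_self hδ) ht hs
    have hst := integral_connForm_sub (a := a) hg hper
      (fun s hs θ hθ => (hball s (hseg s hs) θ hθ).1)
    have hbase : ∫ θ in (-Real.pi)..Real.pi, connForm g (homCoord g t) (t + θ * I)
        = ∫ θ in (-Real.pi)..Real.pi, connForm g a (t + θ * I) := by
      -- This `k` converts the product with `homCoord g t` into the product with `normLift g a t`.
      refine integral_connForm_eq (k := (starRingEnd ℂ (inner ℂ a (homCoord g t)))⁻¹) hg hper
        (fun θ hθ => (hball t ht θ hθ).1) fun θ hθ => ?_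
      have := (hball t ht θ hθ).2
      rwa [normLift, inner_smul_left, map_inv₀] at this
    rw [enclosedArea, hbase, sub_eq_iff_eq_add.1 hst, enclosedArea, ← ha, Complex.add_re,
      Complex.ofReal_re]
    simp only [circleEnergy]
    ring
  have hd : HasDerivAt (fun t => enclosedArea g t₀ + ∫ s in t₀..t, circleEnergy g s)
      (circleEnergy g t₀) t₀ :=
    ((continuous_circleEnergy hg).integral_hasStrictDerivAt t₀ t₀).hasDerivAt.const_add _
  refine hd.congr_of_eventuallyEq ?_
  filter_upwards [Metric.ball_mem_nhds t₀ hδ] with t ht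
  exact hmain t ht

/-- The isoperimetric inequality for the images of vertical segments. -/
theorem mul_enclosedArea_sq_le (hg : IsHolomorphicCurve g) {η : ℝ} (hη : 0 < η) (t : ℝ)
    (hcos : ∀ θ ∈ Set.Icc (-Real.pi) Real.pi, η ≤ cosSqDist g (homCoord g t) (t + θ * I)) :
    2 * η / Real.pi * enclosedArea g t ^ 2 ≤ circleEnergy g t := by
  have hpi := Real.pi_pos
  have hle : -Real.pi ≤ Real.pi := by linarith
  set p : ℝ → ℝ := fun θ => ‖connForm g (homCoord g t) (t + θ * I)‖ with hp
  have hmem : ∀ θ ∈ Set.Icc (-Real.pi) Real.pi,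
      (t + θ * I : ℂ) ∈ avoidSet g (homCoord g t) := by
    intro θ hθ h0
    have := hcos θ hθ
    rw [cosSqDist, h0] at this
    simp at this
    linarith
  have hpc : ContinuousOn p (Set.uIcc (-Real.pi) Real.pi) := by
    rw [Set.uIcc_of_le hle]
    exact ((continuousOn_connForm hg).comp (by fun_prop) hmem).norm
  set A := |enclosedArea g t| with hA
  have hA1 : 2 * A ≤ ∫ θ in (-Real.pi)..Real.pi, p θ := by
    have h1 := intervalIntegral.norm_integral_le_integral_norm
      (f := fun θ : ℝ => connForm g (homCoord g t) (t + θ * I)) (μ := volume) hle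
    refine le_trans ?_ h1
    rw [hA, enclosedArea, abs_div, abs_two]
    have := Complex.abs_re_le_norm
      (∫ θ in (-Real.pi)..Real.pi, connForm g (homCoord g t) (t + θ * I))
    linarith
  have hA0 : 0 ≤ A := abs_nonneg _
  -- Cauchy–Schwarz for integrals, through the tangent line p² ≥ 2mp - m² at m = A/π, the lower
  -- bound for the mean of `p` given by `hA1`.
  have hmono : ∫ θ in (-Real.pi)..Real.pi, η * (2 * (A / Real.pi) * p θ - (A / Real.pi) ^ 2)
      ≤ circleEnergy g t := by
    refine intervalIntegral.integral_mono_on hle ?_ ?_ fun θ hθ => ?_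
    · apply ContinuousOn.intervalIntegrable
      exact continuousOn_const.mul ((continuousOn_const.mul hpc).sub continuousOn_const)
    · have := continuous_energyDensity hg
      apply Continuous.intervalIntegrable
      fun_prop
    · refine le_trans ?_ (norm_sq_connForm_le hg (hmem θ hθ))
      calc η * (2 * (A / Real.pi) * p θ - (A / Real.pi) ^ 2) ≤ η * p θ ^ 2 := by
            gcongr
            nlinarith [sq_nonneg (p θ - A / Real.pi)]
        _ ≤ _ := by
            gcongr
            exact hcos θ hθ
  rw [intervalIntegral.integral_const_mul, intervalIntegral.integral_sub
    (hpc.intervalIntegrable.const_mul _) (by simp),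
    intervalIntegral.integral_const_mul, intervalIntegral.integral_const] at hmono
  refine le_trans ?_ hmono
  rw [← sq_abs (enclosedArea g t), ← hA, smul_eq_mul]
  calc 2 * η / Real.pi * A ^ 2
      = η * (2 * (A / Real.pi) * (2 * A) - (Real.pi - -Real.pi) * (A / Real.pi) ^ 2) := by
        field_simp
        ring
    _ ≤ _ := by gcongr

/-- A curve of period `2πi` with spherical derivative at most `K < 1/2` has vanishing spherical
derivative on a period strip. -/
theorem energyDensity_eq_zero (hg : IsHolomorphicCurve g)
    (hper : ∀ w, homCoord g (w + 2 * Real.pi * I) = homCoord g w)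
    {K : ℝ} (hK0 : 0 ≤ K) (hK : K < 1 / 2) (hS : ∀ w, energyDensity g w ≤ K ^ 2) (t : ℝ) {θ : ℝ}
    (hθ : θ ∈ Set.Icc (-Real.pi) Real.pi) : energyDensity g (t + θ * I) = 0 := by
  have hpi := Real.pi_pos
  set η := (1 + Real.cos (Real.pi * (2 + 2 * K) / 3)) / 2 with hηdef
  have hη : 0 < η := by
    have h1 : Real.cos Real.pi < Real.cos (Real.pi * (2 + 2 * K) / 3) := by
      apply Real.cos_lt_cos_of_nonneg_of_le_pi (by positivity) le_rfl
      nlinarith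
    rw [Real.cos_pi] at h1
    rw [hηdef]
    linarith
  have hcos : ∀ t : ℝ, ∀ θ ∈ Set.Icc (-Real.pi) Real.pi,
      η ≤ cosSqDist g (homCoord g t) (t + θ * I) := by
    intro t θ hθ
    -- Measured from its midpoint, the period consists of two segments of length π, in the
    -- directions `I` and `-I`.
    rcases le_total 0 θ with h0 | h0
    · exact le_cosSqDist hg hK0 hK hS t I (by simp) ⟨h0, hθ.2⟩
    · have := le_cosSqDist hg hK0 hK hS t (-I) (by simp) (s := -θ) ⟨by linarith, by linarith [hθ.1]⟩
      simpa using this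
  have havoid : ∀ t : ℝ, ∀ θ ∈ Set.Icc (-Real.pi) Real.pi,
      (t + θ * I : ℂ) ∈ avoidSet g (homCoord g t) := by
    intro t θ hθ h0
    have := hcos t θ hθ
    rw [cosSqDist, h0] at this
    simp at this
    linarith
  have hκ : 0 < 2 * η / Real.pi := by positivity
  have hSc := continuous_energyDensity hg
  have hEle : ∀ t, circleEnergy g t ≤ 2 * Real.pi * K ^ 2 := by
    intro t
    have h1 : circleEnergy g t ≤ ∫ θ in (-Real.pi)..Real.pi, K ^ 2 := by
      refine intervalIntegral.integral_mono_on (by linarith) ?_ (by simp) fun θ _ => hS _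
      apply Continuous.intervalIntegrable
      fun_prop
    rw [intervalIntegral.integral_const, smul_eq_mul] at h1
    linarith
  have hA0 : ∀ t, enclosedArea g t = 0 := by
    -- The bound on the area comes from the isoperimetric inequality itself, since κA² ≤ E ≤ 2πK².
    refine eq_zero_of_mul_sq_le_deriv hκ (B := Real.sqrt (2 * Real.pi * K ^ 2 / (2 * η / Real.pi)))
      (hasDerivAt_enclosedArea hg hper havoid)
      (fun t => mul_enclosedArea_sq_le hg hη t (hcos t)) fun t => ?_
    apply Real.abs_le_sqrt
    rw [le_div_iff₀ hκ, mul_comm]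
    exact (mul_enclosedArea_sq_le hg hη t (hcos t)).trans (hEle t)
  have hE0 : ∀ t, circleEnergy g t = 0 := by
    intro t
    have h1 := hasDerivAt_enclosedArea hg hper havoid t
    rw [funext hA0] at h1
    exact h1.unique (hasDerivAt_const t 0)
  by_contra hne
  have : 0 < ∫ θ in (-Real.pi)..Real.pi, energyDensity g (t + θ * I) := by
    refine intervalIntegral.integral_pos (by linarith) (by fun_prop)
      (fun _ _ => energyDensity_nonneg _) ⟨θ, hθ, ?_⟩
    exact lt_of_le_of_ne (energyDensity_nonneg _) (Ne.symm hne)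
  exact this.ne' (hE0 t)

end

/-! ### Vanishing energy forces constancy -/

/-- A curve in the plane with vanishing spherical derivative is constant. -/
theorem eq_of_energyDensity_eq_zero {n : ℕ} {g : ↥(Set.univ : Set ℂ) → CProj n}
    (hg : IsHolomorphicCurve g) (h : ∀ w, energyDensity g w = 0) (w w' : ℂ) :
    g ⟨w, Set.mem_univ _⟩ = g ⟨w', Set.mem_univ _⟩ := by
  have hloc : IsLocallyConstant fun w : ℂ => g ⟨w, Set.mem_univ _⟩ := by
    rw [IsLocallyConstant.iff_eventually_eq]
    intro w
    set a := homCoord g w with ha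
    -- Zero energy makes F' proportional to F, and it kills the connection form, so F' is also
    -- orthogonal to F.
    have hd : ∀ z ∈ avoidSet g a, deriv (normLift g a) z = 0 := by
      intro z hz
      have h0 := normLift_ne_zero hz
      have hN : 0 < ‖normLift g a z‖ := norm_pos_iff.2 h0
      have hcos : 0 < cosSqDist g a z := by
        have : a ≠ 0 := homCoord_ne_zero w
        rw [cosSqDist_eq (isReducedRepOn_normLift hg) hz, inner_normLift hz]
        simp only [norm_one, one_pow]
        positivity
      have h1 := norm_sq_connForm_le hg hz
      rw [h z] at h1
      have h2 : connForm g a z = 0 := by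
        by_contra hne
        have : 0 < ‖connForm g a z‖ := norm_pos_iff.2 hne
        have : 0 < cosSqDist g a z * ‖connForm g a z‖ ^ 2 := by positivity
        linarith
      have h3 : inner ℂ (normLift g a z) (deriv (normLift g a) z) = 0 :=
        (div_eq_zero_iff.1 h2).resolve_right (inner_self_ne_zero.2 h0)
      have h4 := energyDensity_normLift hg hz
      rw [h z, h3, norm_zero, zero_pow two_ne_zero, sub_zero] at h4
      have h5 := (div_eq_zero_iff.1 h4.symm).resolve_right (by positivity)
      have h6 := (mul_eq_zero.1 h5).resolve_left (by positivity)
      exact norm_eq_zero.1 (pow_eq_zero_iff two_ne_zero |>.1 h6)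
    obtain ⟨r, hr, hball⟩ := Metric.isOpen_iff.1 (isOpen_avoidSet (a := a) hg) w
      (self_mem_avoidSet w)
    filter_upwards [Metric.ball_mem_nhds w hr] with z hz
    have heq : normLift g a z = normLift g a w := by
      refine Metric.isOpen_ball.is_const_of_deriv_eq_zero (convex_ball w r).isPreconnected
        ((differentiableOn_normLift hg).mono hball) (fun x hx => hd x (hball hx)) hz
        (Metric.mem_ball_self hr)
    obtain ⟨_, h1, e1⟩ := (isReducedRepOn_normLift (a := a) hg).2 z (hball hz)
    obtain ⟨_, h2, e2⟩ := (isReducedRepOn_normLift (a := a) hg).2 w (self_mem_avoidSet w)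
    rw [e1, e2, Projectivization.mk_eq_mk_iff']
    exact ⟨1, by rw [one_smul, heq]⟩
  exact hloc.apply_eq_of_preconnectedSpace w w'

/-! ### Descent to the punctured plane -/

/-- The lift `w ↦ f (exp w)` of a curve in `ℂ*` to the universal cover. -/
def expPullback {n : ℕ} (f : PuncturedPlane → CProj n) (w : ↥(Set.univ : Set ℂ)) : CProj n :=
  f ⟨Complex.exp w, Complex.exp_ne_zero w⟩

section
variable {n : ℕ} {f : PuncturedPlane → CProj n}

theorem isReducedRepNear_comp_exp {F : ℂ → CSpace n} {w : ℂ}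
    (hF : IsReducedRepNear f (Complex.exp w) F) :
    IsReducedRepNear (expPullback f) w (fun z => F (Complex.exp z)) := by
  obtain ⟨U, hU, hwU, hd, hm⟩ := hF
  refine ⟨Complex.exp ⁻¹' U, hU.preimage Complex.continuous_exp, hwU, ?_, fun z hz => ?_⟩
  · exact hd.comp Complex.differentiable_exp.differentiableOn fun z hz => hz
  · obtain ⟨_, h0, e⟩ := hm _ hz
    exact ⟨Set.mem_univ _, h0, e⟩

theorem isHolomorphicCurve_expPullback (hf : IsHolomorphicCurve f) :
    IsHolomorphicCurve (expPullback f) := by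
  intro w
  obtain ⟨F, hF⟩ := hf ⟨Complex.exp w, Complex.exp_ne_zero w⟩
  exact ⟨_, isReducedRepNear_comp_exp hF⟩

/-- The chain rule yields the factor |exp w|, so the weight |z| is absorbed by the logarithmic
coordinate. -/
theorem sphericalDeriv_expPullback (hf : IsHolomorphicCurve f) (w : ℂ) :
    sphericalDeriv (expPullback f) ⟨w, Set.mem_univ _⟩
      = ‖Complex.exp w‖ * sphericalDeriv f ⟨Complex.exp w, Complex.exp_ne_zero w⟩ := by
  obtain ⟨F, hF⟩ := hf ⟨Complex.exp w, Complex.exp_ne_zero w⟩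
  rw [sphericalDeriv_eq f _ F hF,
    sphericalDeriv_eq (expPullback f) ⟨w, Set.mem_univ _⟩ _ (isReducedRepNear_comp_exp hF)]
  obtain ⟨U, hU, hwU, hd, -⟩ := hF
  have h1 := (hd.differentiableAt (hU.mem_nhds hwU)).hasDerivAt
  have h2 := HasDerivAt.scomp w h1 (Complex.hasDerivAt_exp w)
  have h3 : deriv (fun z => F (Complex.exp z)) w = Complex.exp w • deriv F (Complex.exp w) :=
    h2.deriv
  simp only [h3, fubiniStudyLength_smul_right]

theorem sphericalDeriv_nonneg {G : Set ℂ} (f : G → CProj n) (a : G) : 0 ≤ sphericalDeriv f a := by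
  unfold sphericalDeriv
  split_ifs
  · exact Real.sqrt_nonneg _
  · exact le_rfl

/-- A holomorphic curve in `ℂ*` with `|z| f^#(z) ≤ K < 1/2` is constant. -/
theorem isConstantCurve_of_mul_sphericalDeriv_le (hf : IsHolomorphicCurve f) {K : ℝ}
    (hK : K < 1 / 2) (h : ∀ z : PuncturedPlane, ‖(z : ℂ)‖ * sphericalDeriv f z ≤ K) :
    IsConstantCurve f := by
  have hg := isHolomorphicCurve_expPullback hf
  have hK0 : 0 ≤ K := le_trans (mul_nonneg (norm_nonneg _) (sphericalDeriv_nonneg f _))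
    (h ⟨1, one_ne_zero⟩)
  have hper : ∀ w, homCoord (expPullback f) (w + 2 * Real.pi * I) = homCoord (expPullback f) w := by
    intro w
    simp only [homCoord, expPullback, Complex.exp_periodic w]
  have hS : ∀ w, energyDensity (expPullback f) w ≤ K ^ 2 := by
    intro w
    rw [energyDensity, sphericalDeriv_expPullback hf]
    exact pow_le_pow_left₀ (mul_nonneg (norm_nonneg _) (sphericalDeriv_nonneg f _))
      (h ⟨Complex.exp w, Complex.exp_ne_zero w⟩) 2
  have hzero : ∀ w, energyDensity (expPullback f) w = 0 := by
    intro w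
    -- The energy at `w` depends only on exp w, so `w` may be moved into the strip |Im| ≤ π.
    have h1 := energyDensity_eq_zero hg hper hK0 hK hS (Complex.log (Complex.exp w)).re
      (θ := (Complex.log (Complex.exp w)).im)
      ⟨(Complex.neg_pi_lt_log_im _).le, Complex.log_im_le_pi _⟩
    rw [Complex.re_add_im] at h1
    simp only [energyDensity, sphericalDeriv_expPullback hf,
      Complex.exp_log (Complex.exp_ne_zero w)] at h1 ⊢
    exact h1
  refine ⟨f ⟨1, one_ne_zero⟩, fun z => ?_⟩
  have h1 := eq_of_energyDensity_eq_zero hg hzero (Complex.log z) 0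
  have hz : (z : ℂ) ≠ 0 := z.2
  simpa only [expPullback, Complex.exp_log hz, Complex.exp_zero, Subtype.coe_eta] using h1

theorem IsConstantCurve.exists_isReducedRepNear (hf : IsConstantCurve f) :
    ∃ v : CSpace n, ∀ a : PuncturedPlane, IsReducedRepNear f a fun _ => v := by
  obtain ⟨p, hp⟩ := hf
  refine ⟨p.rep, fun a => ⟨PuncturedPlane, isOpen_compl_singleton, a.2,
    differentiableOn_const _, fun z hz => ⟨hz, p.rep_nonzero, ?_⟩⟩⟩
  rw [hp, Projectivization.mk_rep]

theorem IsConstantCurve.sphericalDeriv_eq_zero (hf : IsConstantCurve f) (a : PuncturedPlane) :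
    sphericalDeriv f a = 0 := by
  obtain ⟨v, hv⟩ := hf.exists_isReducedRepNear
  rw [sphericalDeriv_eq f a _ (hv a), deriv_const]
  simp [fubiniStudyLength]

end

end

theorem theorem7 :
    (∀ (n : ℕ) (f : PuncturedPlane → CProj n),
      IsHolomorphicCurve f → ¬ IsConstantCurve f → ((1 / 2 : ℝ) : EReal) ≤ normalitySup f) ∧
    (∀ K : ℝ, 0 < K → K < 1 / 2 → OstrowskiClass K = {f | IsConstantCurve f}) := by
  have hle : ∀ (n : ℕ) (K : ℝ) (f : PuncturedPlane → CProj n), normalitySup f ≤ (K : EReal) →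
      ∀ z : PuncturedPlane, ‖(z : ℂ)‖ * sphericalDeriv f z ≤ K := by
    intro n K f h z
    exact EReal.coe_le_coe_iff.1 ((le_iSup (fun z : PuncturedPlane =>
      ((‖(z : ℂ)‖ * sphericalDeriv f z : ℝ) : EReal)) z).trans h)
  refine ⟨fun n f hf hnc => ?_, fun K hK0 hK => ?_⟩
  · by_contra! hlt
    -- A supremum below 1/2 leaves room for a real bound `K` still below 1/2.
    obtain ⟨K, hK1, hK2⟩ := EReal.lt_iff_exists_real_btwn.1 hlt
    exact hnc (isConstantCurve_of_mul_sphericalDeriv_le hf (EReal.coe_lt_coe_iff.1 hK2)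
      (hle n K f hK1.le))
  · ext f
    constructor
    · exact fun hf => isConstantCurve_of_mul_sphericalDeriv_le hf.1 hK (hle 1 K f hf.2)
    · intro hf
      obtain ⟨v, hv⟩ := IsConstantCurve.exists_isReducedRepNear hf
      refine ⟨fun a => ⟨_, hv a⟩, iSup_le fun z => ?_⟩
      rw [IsConstantCurve.sphericalDeriv_eq_zero hf, mul_zero]
      exact EReal.coe_le_coe_iff.2 hK0.le
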